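/- Let $d\ge 1$. For a finite family $P$ of $n\ge 1$ points in $\mathbb{R}^d$ (points may coincide) and $0\le k\le n$, consider the problem of selecting $k$ of the points so that the sum $|S|$ of the $L_1$ distances over all unordered pairs of points of the selection $S$ is minimum; let $\mathrm{OPT}$ denote an optimal selection. The algorithm MM considers all candidate medians, i.e. all points $c\in\mathbb{R}^d$ such that for each $j$ the $j$-th coordinate of $c$ is the $j$-th coordinate of some point of $P$; for each candidate median $c$ it takes $k$ points of $P$ closest to $c$ in the $L_1$ metric, breaking ties arbitrarily, and among the selections so obtained it returns one, $\mathrm{MM}$, for which $|\mathrm{MM}|$ is smallest. Then MM is a $\left(2-\frac{1}{2d}\right)$-approximation algorithm, and this is tight: 1. For all $n\ge 1$, $k\le n$ and $P$ there are at most $n^d$ candidate medians, MM has an output, and every possible output of MM (for every way of breaking ties) is a selection of $k$ points with $|\mathrm{MM}|\le\left(2-\frac1{2d}\right)|\mathrm{OPT}|$. 2. For every real $\rho<2-\frac1{2d}$ there are $n\ge 1$, $k\le n$ and pairwise distinct points $P$ in $\mathbb{R}^d$ with $|\mathrm{OPT}|>0$ such that every possible output of MM satisfies $|\mathrm{MM}|>\rho\,|\mathrm{OPT}|$.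 -/

import Mathlib

/-- The `L₁` (Manhattan) distance in `d`-dimensional space. -/
def l1Dist {d : ℕ} (x y : Fin d → ℝ) : ℝ := ∑ j, |x j - y j|

/-- The sum of the `L₁` distances over all unordered pairs of points with indices in `S`;
every unordered pair occurs twice in the double sum, hence the factor `1 / 2`. -/
noncomputable def totalDist {n d : ℕ} (P : Fin n → Fin d → ℝ) (S : Finset (Fin n)) : ℝ :=
  (1 / 2) * ∑ i ∈ S, ∑ j ∈ S, l1Dist (P i) (P j)

/-- `T` is an optimal solution: a selection of `k` of the points `P` whose total pairwise
distance is minimum among all selections of `k` points. -/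
def IsOptimal {n d : ℕ} (P : Fin n → Fin d → ℝ) (k : ℕ) (T : Finset (Fin n)) : Prop :=
  T.card = k ∧ ∀ T' : Finset (Fin n), T'.card = k → totalDist P T ≤ totalDist P T'

/-- The candidate medians: all points each of whose coordinates is the corresponding coordinate
of some input point, i.e. the intersection points of the axis-orthogonal hyperplanes
through the input points. -/
noncomputable def candidateMedians {n d : ℕ} (P : Fin n → Fin d → ℝ) : Finset (Fin d → ℝ) :=
  Finset.univ.image fun f : Fin d → Fin n => fun j => P (f j) j

/-- `S` consists of `k` of the points that are closest to `c`, ties being broken in some way. -/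
def IsKNearest {n d : ℕ} (P : Fin n → Fin d → ℝ) (k : ℕ) (c : Fin d → ℝ)
    (S : Finset (Fin n)) : Prop :=
  S.card = k ∧ ∀ i ∈ S, ∀ j ∉ S, l1Dist (P i) c ≤ l1Dist (P j) c

/-- `S` is a possible output of the algorithm MM on the points `P` and the number `k`: for every
candidate median `c`, the algorithm takes a set `sel c` of `k` points closest to `c`, breaking
ties arbitrarily, and it returns one of these sets with smallest total pairwise distance. -/
def IsMMOutput {n d : ℕ} (P : Fin n → Fin d → ℝ) (k : ℕ) (S : Finset (Fin n)) : Prop :=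
  ∃ sel : (Fin d → ℝ) → Finset (Fin n),
    (∀ c ∈ candidateMedians P, IsKNearest P k c (sel c)) ∧
    ∃ c ∈ candidateMedians P, S = sel c ∧
      ∀ c' ∈ candidateMedians P, totalDist P (sel c) ≤ totalDist P (sel c')

/-! Upper bound. MM tries a coordinatewise median `c` of the optimal selection `T`, so it suffices
to bound the selection `S` nearest to `c`. Centre at `c` and cut the `L₁` metric into layers: one
for each of the `2 d` half axes and each level `t ≥ 0`. In a layer every point is `0` or `1`, and a
selection with `a` ones among `k` points has pair sum `a * (k - a)`; the median property says that
`T` has at most `k / 2` ones.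

No layerwise comparison of `S` and `T` holds by itself. Two global facts help: with `r` the radius
of `S`, points of `S \ T` have norm at most `r`, and points of `T \ S` have norm at least `r` and
can be shrunk to exactly `r`. `exists_layer_multipliers` adds these as Lagrange terms to an
inequality for one layer, with multipliers independent of the layer. Integrated over `[0, r]` and
summed over the half axes, the terms become nonpositive (`sum_sum_dist_le_of_median`).

Tightness. Put `N = 2 d` coincident points at the origin and `N` at the first unit vector, with
satellites at distance `δ < 1` around each. The two clusters alone form a selection of `k = 2 N`
points with cost `N ^ 2`. Every candidate median lies outside the slab between the clusters, so its
nearest selection holds one whole cluster and `N` scattered points, at cost at least `δ * (2 * N ^ 2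
- N)` (`le_sum_sum_of_nearest_side`). Let `δ` tend to `1`; a small perturbation makes the points
distinct. -/

open MeasureTheory Filter Topology

/-! ### The inequality for a single layer. -/

/-- Lagrange multipliers for the comparison of one layer of a nearest selection with the same
layer of an optimal one. -/
theorem exists_layer_multipliers {L s : ℝ} (hL : 0 < L) (hL4 : L ≤ 1 / 4) (hs : 0 < s) :
    ∃ l β : ℝ, l ≤ 1 / 2 ∧ ∀ p q x : ℝ, 0 ≤ p → 0 ≤ q → 0 ≤ x → q ≤ s → p + q ≤ 1 / 2 →
      (p + x) * (1 - p - x) ≤ (2 - 2 * L) * ((p + q) * (1 - p - q)) +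
        (1 - 2 * l) * (x - q) + β * (2 * L * s - q) := by
  rcases le_total L ((2 - 2 * L) * s) with h | h
  -- The slope `1 - 2 * l` is that of `a * (1 - a)` at `a = l`, so the tangent there, i.e. the
  -- square `(x + p - l) ^ 2`, eliminates `x`. For large `s` the tangent point can be `L`.
  · refine ⟨L, L / (2 * s), by linarith, fun p q x hp hq hx hqs hpq => ?_⟩
    have e : L / (2 * s) * (2 * L * s - q) = L ^ 2 - L * (q / s) / 2 := by
      field_simp
    have hqs1 : q / s ≤ 1 := (div_le_one hs).2 hqs
    have key : L * (q / s) / 2 ≤ (p + q) * (1 - (2 - 2 * L) * (p + q)) := by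
      rcases le_total L ((2 - 2 * L) * (p + q)) with h' | h'
      · nlinarith [mul_nonneg (sub_nonneg.2 h') (by linarith : 0 ≤ 1 / 2 - (p + q))]
      · have h1 : L * (q / s) ≤ (2 - 2 * L) * q := by
          rw [mul_div_assoc', div_le_iff₀ hs]
          nlinarith
        have h2 : 0 ≤ (p + q) * (L - (2 - 2 * L) * (p + q)) :=
          mul_nonneg (by linarith) (by linarith)
        nlinarith
    rw [e]
    nlinarith [sq_nonneg (x + p - L)]
  · have hs6 : s ≤ 1 / 6 := by nlinarith
    refine ⟨2 * L * s, 2 * L * s, by nlinarith, fun p q x hp hq hx hqs hpq => ?_⟩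
    have hl : 2 * L * s ≤ 1 / 12 := by nlinarith
    have hl0 : 0 < 2 * L * s := by positivity
    have hlq : 2 * L * q ≤ 2 * L * s := by nlinarith
    set l := 2 * L * s
    rcases le_total p l with hpl | hpl
    · have h1 : 1 - l ≤ (2 - 2 * L) * (1 - p - q) := by nlinarith
      have h2 : (1 - l) * (p + q) ≤ (2 - 2 * L) * (1 - p - q) * (p + q) :=
        mul_le_mul_of_nonneg_right h1 (by linarith)
      nlinarith [sq_nonneg (x + p - l), mul_nonneg hl0.le hp]
    -- Beyond the tangent point `x = 0` is the worst case. After `l * q` is bounded below by `2 * L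
    -- * q ^ 2`, what remains is `h0`, its value at `L = 1 / 4`, plus twice `h1`, the correction for
    -- smaller `L`.
    · have h0 : 0 ≤ p / 2 - p ^ 2 / 2 + q / 2 - 3 * p * q - q ^ 2 := by
        nlinarith [mul_nonneg hp (by linarith : 0 ≤ 1 / 2 - p - q),
          mul_nonneg hq (by linarith : 0 ≤ 1 / 6 - q), mul_nonneg hp hq,
          mul_nonneg hq (by linarith : 0 ≤ 1 / 2 - p - q),
          mul_nonneg (by linarith : 0 ≤ 1 / 6 - q) (by linarith : 0 ≤ 1 / 2 - p - q)]
      have h1 : 0 ≤ (1 / 4 - L) * (p + q - (p + q) ^ 2 - q ^ 2) := by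
        apply mul_nonneg (by linarith)
        nlinarith
      have h2 : 0 ≤ x * (p - l) := mul_nonneg hx (by linarith)
      have h3 : 0 ≤ q * (l - 2 * L * q) := mul_nonneg hq (by linarith)
      nlinarith [sq_nonneg x, sq_nonneg l]

/-! ### Layer-cake integrals on `[0, r]`. -/

/-- The indicator of `t < a`. -/
noncomputable def layer (a t : ℝ) : ℝ := if t < a then 1 else 0

theorem layer_nonneg (a t : ℝ) : 0 ≤ layer a t := by
  unfold layer; split_ifs <;> norm_num

theorem layer_le_layer {a b : ℝ} (h : a ≤ b) (t : ℝ) : layer a t ≤ layer b t := by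
  unfold layer; split_ifs <;> linarith

theorem abs_layer_sub_layer (a b t : ℝ) :
    |layer a t - layer b t| = layer a t + layer b t - 2 * (layer a t * layer b t) := by
  unfold layer; split_ifs <;> norm_num

theorem layer_mul_layer (a b t : ℝ) : layer a t * layer b t = layer (min a b) t := by
  unfold layer
  by_cases h1 : t < a <;> by_cases h2 : t < b <;> simp [h1, h2]

theorem intervalIntegrable_layer (a x y : ℝ) : IntervalIntegrable (layer a) volume x y := by
  have : Antitone (layer a) := by
    intro s t hst
    unfold layer; split_ifs <;> linarith
  exact this.intervalIntegrable

theorem integral_layer {a r : ℝ} (hr : 0 ≤ r) :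
    ∫ t in (0 : ℝ)..r, layer a t = max 0 (min a r) := by
  have hm : 0 ≤ max 0 (min a r) := le_max_left _ _
  rw [← intervalIntegral.integral_add_adjacent_intervals
    (intervalIntegrable_layer a 0 (max 0 (min a r))) (intervalIntegrable_layer a _ r)]
  have h1 : ∫ t in (0 : ℝ)..max 0 (min a r), layer a t = ∫ t in (0 : ℝ)..max 0 (min a r), 1 := by
    apply intervalIntegral.integral_congr_Ioo_of_le hm
    intro t ht
    have : t < a := by
      rcases max_cases 0 (min a r) with h | h
      · rw [h.1] at ht; exact absurd ht.1 (not_lt.2 ht.2.le)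
      · rw [h.1] at ht; exact ht.2.trans_le (min_le_left _ _)
    simp [layer, this]
  have h2 : ∫ t in max 0 (min a r)..r, layer a t = ∫ t in max 0 (min a r)..r, 0 := by
    apply intervalIntegral.integral_congr_Ioo_of_le (max_le hr (min_le_right _ _))
    intro t ht
    have h3 : min a r < t := (le_max_right _ _).trans_lt ht.1
    have : ¬ t < a := by
      rcases min_lt_iff.1 h3 with h | h
      · exact not_lt.2 h.le
      · exact absurd ht.2 (not_lt.2 h.le)
    simp [layer, this]
  rw [h1, h2]
  simp

theorem integral_abs_layer_sub {a b r : ℝ} (hr : 0 ≤ r) :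
    ∫ t in (0 : ℝ)..r, |layer a t - layer b t| =
      |max 0 (min a r) - max 0 (min b r)| := by
  have ha := intervalIntegrable_layer a 0 r
  have hb := intervalIntegrable_layer b 0 r
  have hm := intervalIntegrable_layer (min a b) 0 r
  simp_rw [abs_layer_sub_layer, layer_mul_layer]
  rw [intervalIntegral.integral_sub (ha.add hb) (hm.const_mul 2),
    intervalIntegral.integral_add ha hb, intervalIntegral.integral_const_mul,
    integral_layer hr, integral_layer hr, integral_layer hr]
  rcases le_total a b with h | h
  · have : max 0 (min a r) ≤ max 0 (min b r) := max_le_max_left _ (min_le_min_right _ h)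
    rw [min_eq_left h, abs_of_nonpos (by linarith)]; ring
  · have : max 0 (min b r) ≤ max 0 (min a r) := max_le_max_left _ (min_le_min_right _ h)
    rw [min_eq_right h, abs_of_nonneg (by linarith)]; ring

theorem intervalIntegrable_abs_layer_sub (a b x y : ℝ) :
    IntervalIntegrable (fun t => |layer a t - layer b t|) volume x y := by
  exact ((intervalIntegrable_layer a x y).sub (intervalIntegrable_layer b x y)).abs

/-! ### Splitting the `L₁` metric along the half axes. -/

/-- The coordinate of `x` along one of the `2 d` half axes. -/
def halfCoord {d : ℕ} (x : Fin d → ℝ) (h : Fin d × Bool) : ℝ :=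
  if h.2 then x h.1 else -x h.1

theorem abs_halfCoord_le {d : ℕ} (x : Fin d → ℝ) (h : Fin d × Bool) :
    |halfCoord x h| ≤ ∑ j, |x j| := by
  have : |halfCoord x h| = |x h.1| := by unfold halfCoord; split_ifs <;> simp
  rw [this]
  exact Finset.single_le_sum (f := fun j => |x j|) (fun _ _ => abs_nonneg _) (Finset.mem_univ _)

/-- In each coordinate the distance of two reals is the sum of the distances of their positive parts
and of their negative parts. -/
theorem sum_abs_max_sub_max {d : ℕ} (x y : Fin d → ℝ) :
    ∑ h, |max 0 (halfCoord x h) - max 0 (halfCoord y h)| = ∑ j, |x j - y j| := by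
  rw [Fintype.sum_prod_type]
  refine Finset.sum_congr rfl fun j _ => ?_
  simp only [halfCoord, Fintype.sum_bool, if_true, Bool.false_eq_true, if_false]
  rcases le_total 0 (x j) with hx | hx <;> rcases le_total 0 (y j) with hy | hy <;>
    simp only [max_eq_left, max_eq_right, hx, hy, neg_nonneg, neg_nonpos, sub_self, abs_zero,
      add_zero, zero_add, sub_zero, zero_sub]
  · rw [abs_neg, abs_neg, abs_of_nonneg hx, abs_of_nonpos hy, abs_of_nonneg (by linarith)]; ring
  · rw [abs_neg, abs_neg, abs_of_nonpos hx, abs_of_nonneg hy, abs_of_nonpos (by linarith)]; ring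
  · rw [← abs_neg]; ring_nf

theorem sum_max_halfCoord {d : ℕ} (x : Fin d → ℝ) :
    ∑ h, max 0 (halfCoord x h) = ∑ j, |x j| := by
  have := sum_abs_max_sub_max x 0
  rw [show ∑ j, |x j - (0 : Fin d → ℝ) j| = ∑ j, |x j| by simp] at this
  rw [← this]
  refine Finset.sum_congr rfl fun h _ => ?_
  rw [show halfCoord (0 : Fin d → ℝ) h = 0 by simp [halfCoord], max_self, sub_zero,
    abs_of_nonneg (le_max_left _ _)]

/-! ### Pair sums by layers, and the comparison at a median. -/

/-- The ordered sum of the distances between the points of a two-valued family. -/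
theorem sum_sum_abs_layer {ι : Type*} (S : Finset ι) (w : ι → ℝ) (t : ℝ) :
    ∑ i ∈ S, ∑ j ∈ S, |layer (w i) t - layer (w j) t| =
      2 * ((∑ i ∈ S, layer (w i) t) * (S.card - ∑ i ∈ S, layer (w i) t)) := by
  simp_rw [abs_layer_sub_layer, Finset.sum_sub_distrib, Finset.sum_add_distrib, ← Finset.mul_sum,
    ← Finset.sum_mul, Finset.sum_const, nsmul_eq_mul]
  rw [← Finset.mul_sum]
  ring

theorem integral_sum_sum_abs_layer {ι : Type*} (S : Finset ι) (w : ι → ℝ) {r : ℝ} (hr : 0 ≤ r) :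
    ∫ t in (0 : ℝ)..r, ∑ i ∈ S, ∑ j ∈ S, |layer (w i) t - layer (w j) t| =
      ∑ i ∈ S, ∑ j ∈ S, |max 0 (min (w i) r) - max 0 (min (w j) r)| := by
  rw [intervalIntegral.integral_finsetSum]
  · refine Finset.sum_congr rfl fun i _ => ?_
    rw [intervalIntegral.integral_finsetSum]
    · exact Finset.sum_congr rfl fun j _ => integral_abs_layer_sub hr
    · exact fun j _ => intervalIntegrable_abs_layer_sub _ _ _ _
  · intro i _
    have := IntervalIntegrable.sum (μ := volume) (a := 0) (b := r) S
      (f := fun j t => |layer (w i) t - layer (w j) t|)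
      (fun j _ => intervalIntegrable_abs_layer_sub _ _ _ _)
    simpa [Finset.sum_fn] using this

theorem intervalIntegrable_sum_sum_abs_layer {ι : Type*} (S : Finset ι) (w : ι → ℝ) (r : ℝ) :
    IntervalIntegrable (fun t => ∑ i ∈ S, ∑ j ∈ S, |layer (w i) t - layer (w j) t|)
      volume 0 r := by
  have := IntervalIntegrable.sum (μ := volume) (a := 0) (b := r) S
    (f := fun i t => ∑ j ∈ S, |layer (w i) t - layer (w j) t|) (fun i _ => by
    have := IntervalIntegrable.sum (μ := volume) (a := 0) (b := r) S
      (f := fun j t => |layer (w i) t - layer (w j) t|)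
      (fun j _ => intervalIntegrable_abs_layer_sub _ _ _ _)
    simpa [Finset.sum_fn] using this)
  simpa [Finset.sum_fn] using this

theorem intervalIntegrable_sum_layer {ι : Type*} (S : Finset ι) (w : ι → ℝ) (r : ℝ) :
    IntervalIntegrable (fun t => ∑ i ∈ S, layer (w i) t) volume 0 r := by
  have := IntervalIntegrable.sum (μ := volume) (a := 0) (b := r) S
    (f := fun i t => layer (w i) t) (fun i _ => intervalIntegrable_layer _ _ _)
  simpa [Finset.sum_fn] using this

theorem integral_sum_layer {ι : Type*} (S : Finset ι) (w : ι → ℝ) {r : ℝ} (hr : 0 ≤ r) :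
    ∫ t in (0 : ℝ)..r, ∑ i ∈ S, layer (w i) t = ∑ i ∈ S, max 0 (min (w i) r) := by
  rw [intervalIntegral.integral_finsetSum fun i _ => intervalIntegrable_layer _ _ _]
  exact Finset.sum_congr rfl fun i _ => integral_layer hr

/-- The comparison of a nearest selection with an optimal one, for vectors centred at a
coordinatewise median of the optimal selection. -/
theorem sum_sum_dist_le_of_median {ι : Type*} [DecidableEq ι] {d : ℕ} (hd : 1 ≤ d)
    (S T : Finset ι) (hST : S.card = T.card) (hne : S ≠ T)
    (v : ι → Fin d → ℝ) {r : ℝ} (hr : 0 < r)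
    (hS : ∀ i ∈ S, ∑ j, |v i j| ≤ r) (hT : ∀ i ∈ T \ S, r ≤ ∑ j, |v i j|)
    (hmed : ∀ h t, 0 ≤ t → 2 * ∑ i ∈ T, layer (halfCoord (v i) h) t ≤ T.card) :
    ∑ i ∈ S, ∑ i' ∈ S, ∑ j, |v i j - v i' j| ≤
      (2 - 2 * (1 / (4 * (d : ℝ)))) * ∑ i ∈ T, ∑ i' ∈ T, ∑ j, |v i j - v i' j| := by
  have hd' : (1 : ℝ) ≤ d := by exact_mod_cast hd
  set L : ℝ := 1 / (4 * (d : ℝ)) with hLdef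
  have hL : 0 < L := by positivity
  have hL4 : L ≤ 1 / 4 := by
    rw [hLdef]; exact one_div_le_one_div_of_le (by norm_num) (by linarith)
  have hdL : 4 * d * L = 1 := by rw [hLdef]; field_simp
  set Y := T \ S with hY
  set X := S \ T with hX
  set I := S ∩ T with hI
  have hYcard : X.card = Y.card := Finset.card_sdiff_comm hST
  have hYpos : 0 < Y.card := by
    rw [Finset.card_pos, Finset.sdiff_nonempty]
    exact fun h => hne (Finset.eq_of_subset_of_card_le h hST.le).symm
  have hYT : Y.card ≤ T.card := Finset.card_le_card Finset.sdiff_subset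
  set k : ℝ := (T.card : ℝ) with hk
  have hkpos : 0 < k := by rw [hk]; exact_mod_cast hYpos.trans_le hYT
  have hypos : (0 : ℝ) < Y.card := by exact_mod_cast hYpos
  -- The multipliers depend only on `L` and `|Y| / k`, not on the half axis or level, so the layer
  -- inequality can be integrated.
  obtain ⟨l, β, hl, hpw⟩ := exists_layer_multipliers hL hL4 (div_pos hypos hkpos)
  -- the sums over `S` and `T` split along the intersection
  have splitS : ∀ f : ι → ℝ, ∑ i ∈ S, f i = ∑ i ∈ I, f i + ∑ i ∈ X, f i := fun f => by
    rw [hI, hX, Finset.sum_inter_add_sum_sdiff]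
  have splitT : ∀ f : ι → ℝ, ∑ i ∈ T, f i = ∑ i ∈ I, f i + ∑ i ∈ Y, f i := fun f => by
    rw [hI, hY, Finset.inter_comm, Finset.sum_inter_add_sum_sdiff]
  -- the points of `Y`, moved radially to norm `r`
  let y : ι → Fin d × Bool → ℝ := fun i h => r / (∑ j, |v i j|) * halfCoord (v i) h
  have hylayer : ∀ i ∈ Y, ∀ h t, 0 ≤ t → layer (y i h) t ≤ layer (halfCoord (v i) h) t := by
    intro i hi h t ht
    have h0 : 0 < ∑ j, |v i j| := hr.trans_le (hT i hi)
    have h1 : r / (∑ j, |v i j|) ≤ 1 := (div_le_one h0).2 (hT i hi)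
    have h2 : 0 < r / (∑ j, |v i j|) := by positivity
    rcases le_total (halfCoord (v i) h) 0 with h3 | h3
    · have : ¬ t < y i h := not_lt.2 ((mul_nonpos_of_nonneg_of_nonpos h2.le h3).trans ht)
      simp only [layer, this, if_false]
      split_ifs <;> norm_num
    · exact layer_le_layer (mul_le_of_le_one_left h3 h1) t
  have hysum : ∀ i ∈ Y, ∑ h, max 0 (min (y i h) r) = r := by
    intro i hi
    have h0 : 0 < ∑ j, |v i j| := hr.trans_le (hT i hi)
    have h2 : 0 < r / (∑ j, |v i j|) := by positivity
    have : ∀ h, max 0 (min (y i h) r) = r / (∑ j, |v i j|) * max 0 (halfCoord (v i) h) := by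
      intro h
      have h3 : y i h ≤ r := by
        have := (le_abs_self _).trans (abs_halfCoord_le (v i) h)
        calc y i h ≤ r / (∑ j, |v i j|) * ∑ j, |v i j| := mul_le_mul_of_nonneg_left this h2.le
          _ = r := by field_simp
      rw [min_eq_left h3, mul_max_of_nonneg _ _ h2.le, mul_zero]
    simp_rw [this]
    rw [← Finset.mul_sum, sum_max_halfCoord]
    field_simp
  -- the inequality of the layers
  have hlayer : ∀ h t, 0 ≤ t →
      ∑ i ∈ S, ∑ i' ∈ S, |layer (halfCoord (v i) h) t - layer (halfCoord (v i') h) t| +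
        (2 * k * (1 - 2 * l) + 2 * k * β) * ∑ i ∈ Y, layer (y i h) t ≤
      (2 - 2 * L) *
        ∑ i ∈ T, ∑ i' ∈ T, |layer (halfCoord (v i) h) t - layer (halfCoord (v i') h) t| +
        2 * k * (1 - 2 * l) * ∑ i ∈ X, layer (halfCoord (v i) h) t +
        4 * k * β * L * Y.card := by
    intro h t ht
    rw [sum_sum_abs_layer, sum_sum_abs_layer, hST]
    have hz := hmed h t ht
    rw [splitS, splitT] at *
    set p := ∑ i ∈ I, layer (halfCoord (v i) h) t with hp
    set x := ∑ i ∈ X, layer (halfCoord (v i) h) t with hx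
    set z := ∑ i ∈ Y, layer (halfCoord (v i) h) t with hz'
    set q := ∑ i ∈ Y, layer (y i h) t with hq
    have hqz : q ≤ z := Finset.sum_le_sum fun i hi => hylayer i hi h t ht
    have hp0 : 0 ≤ p := Finset.sum_nonneg fun i _ => layer_nonneg _ _
    have hx0 : 0 ≤ x := Finset.sum_nonneg fun i _ => layer_nonneg _ _
    have hq0 : 0 ≤ q := Finset.sum_nonneg fun i _ => layer_nonneg _ _
    have hqY : q ≤ Y.card := by
      calc q ≤ ∑ i ∈ Y, (1 : ℝ) := Finset.sum_le_sum fun i _ => by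
            unfold layer; split_ifs <;> norm_num
        _ = Y.card := by simp
    rw [← hk]
    have key := hpw (p / k) (q / k) (x / k) (by positivity) (by positivity) (by positivity)
      (div_le_div_of_nonneg_right hqY hkpos.le) (by rw [← add_div, div_le_iff₀ hkpos]; linarith)
    have key2 := mul_le_mul_of_nonneg_left key (by positivity : 0 ≤ 2 * k ^ 2)
    have e1 : 2 * k ^ 2 * ((p / k + x / k) * (1 - p / k - x / k)) =
        2 * ((p + x) * (k - (p + x))) := by field_simp; ring
    have e2 : 2 * k ^ 2 * ((2 - 2 * L) * ((p / k + q / k) * (1 - p / k - q / k)) +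
        (1 - 2 * l) * (x / k - q / k) + β * (2 * L * (Y.card / k) - q / k)) =
        (2 - 2 * L) * (2 * ((p + q) * (k - (p + q)))) + 2 * k * (1 - 2 * l) * (x - q) +
        2 * k * β * (2 * L * Y.card - q) := by field_simp; ring
    rw [e1, e2] at key2
    -- `a * (k - a)` increases up to `k / 2`, and the median property keeps `p + z` there; so
    -- shrinking `Y` only lowers the cost of `T`.
    have mono : (p + q) * (k - (p + q)) ≤ (p + z) * (k - (p + z)) := by
      nlinarith [mul_nonneg (sub_nonneg.2 hqz) (by linarith : 0 ≤ k - (p + z) - (p + q))]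
    have := mul_le_mul_of_nonneg_left mono (by linarith : 0 ≤ (2 - 2 * L) * 2)
    linarith
  -- integration of the layers
  have hint : ∀ h,
      ∑ i ∈ S, ∑ i' ∈ S, |max 0 (halfCoord (v i) h) - max 0 (halfCoord (v i') h)| +
        (2 * k * (1 - 2 * l) + 2 * k * β) * ∑ i ∈ Y, max 0 (min (y i h) r) ≤
      (2 - 2 * L) *
        ∑ i ∈ T, ∑ i' ∈ T, |max 0 (halfCoord (v i) h) - max 0 (halfCoord (v i') h)| +
        2 * k * (1 - 2 * l) * ∑ i ∈ X, max 0 (halfCoord (v i) h) +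
        r * (4 * k * β * L * Y.card) := by
    intro h
    have iS := intervalIntegrable_sum_sum_abs_layer S (fun i => halfCoord (v i) h) r
    have iT := (intervalIntegrable_sum_sum_abs_layer T (fun i => halfCoord (v i) h) r).const_mul
      (2 - 2 * L)
    have iY := (intervalIntegrable_sum_layer Y (fun i => y i h) r).const_mul
      (2 * k * (1 - 2 * l) + 2 * k * β)
    have iX := (intervalIntegrable_sum_layer X (fun i => halfCoord (v i) h) r).const_mul
      (2 * k * (1 - 2 * l))
    have iC : IntervalIntegrable (fun _ : ℝ => 4 * k * β * L * Y.card) volume 0 r :=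
      intervalIntegrable_const
    have := intervalIntegral.integral_mono_on hr.le (iS.add iY) ((iT.add iX).add iC)
      fun t ht => hlayer h t ht.1
    rw [intervalIntegral.integral_add iS iY, intervalIntegral.integral_add (iT.add iX) iC,
      intervalIntegral.integral_add iT iX, intervalIntegral.integral_const_mul,
      intervalIntegral.integral_const_mul, intervalIntegral.integral_const_mul,
      integral_sum_sum_abs_layer S _ hr.le, integral_sum_sum_abs_layer T _ hr.le,
      integral_sum_layer Y _ hr.le, integral_sum_layer X _ hr.le,
      intervalIntegral.integral_const, sub_zero, smul_eq_mul] at this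
    have hSr : ∀ i ∈ S, min (halfCoord (v i) h) r = halfCoord (v i) h := fun i hi =>
      min_eq_left (((le_abs_self _).trans (abs_halfCoord_le _ _)).trans (hS i hi))
    have eS : ∑ i ∈ S, ∑ i' ∈ S,
        |max 0 (min (halfCoord (v i) h) r) - max 0 (min (halfCoord (v i') h) r)| =
        ∑ i ∈ S, ∑ i' ∈ S, |max 0 (halfCoord (v i) h) - max 0 (halfCoord (v i') h)| :=
      Finset.sum_congr rfl fun i hi => Finset.sum_congr rfl fun i' hi' => by
        rw [hSr i hi, hSr i' hi']
    have eX : ∑ i ∈ X, max 0 (min (halfCoord (v i) h) r) = ∑ i ∈ X, max 0 (halfCoord (v i) h) :=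
      Finset.sum_congr rfl fun i hi => by rw [hSr i (Finset.sdiff_subset hi)]
    -- Clipping at `r` is a contraction; for `S` and `X` it changes nothing.
    have eT : ∑ i ∈ T, ∑ i' ∈ T,
        |max 0 (min (halfCoord (v i) h) r) - max 0 (min (halfCoord (v i') h) r)| ≤
        ∑ i ∈ T, ∑ i' ∈ T, |max 0 (halfCoord (v i) h) - max 0 (halfCoord (v i') h)| := by
      refine Finset.sum_le_sum fun i _ => Finset.sum_le_sum fun i' _ => ?_
      have := abs_min_sub_min_le_max (max 0 (halfCoord (v i) h)) r (max 0 (halfCoord (v i') h)) r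
      rw [sub_self, abs_zero] at this
      rw [max_min_distrib_left, max_min_distrib_left, max_eq_right hr.le]
      exact this.trans (max_le le_rfl (abs_nonneg _))
    rw [eS, eX] at this
    have := mul_le_mul_of_nonneg_left eT (by linarith : 0 ≤ 2 - 2 * L)
    linarith
  have hsum := Finset.sum_le_sum fun h (_ : h ∈ (Finset.univ : Finset (Fin d × Bool))) => hint h
  have swap2 : ∀ U : Finset ι,
      ∑ h, ∑ i ∈ U, ∑ i' ∈ U, |max 0 (halfCoord (v i) h) - max 0 (halfCoord (v i') h)| =
      ∑ i ∈ U, ∑ i' ∈ U, ∑ j, |v i j - v i' j| := by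
    intro U
    rw [Finset.sum_comm]
    refine Finset.sum_congr rfl fun i _ => ?_
    rw [Finset.sum_comm]
    exact Finset.sum_congr rfl fun i' _ => sum_abs_max_sub_max _ _
  simp only [Finset.sum_add_distrib, ← Finset.mul_sum, swap2] at hsum
  rw [Finset.sum_comm (s := Finset.univ) (t := Y), Finset.sum_comm (s := Finset.univ) (t := X),
    Finset.sum_congr rfl hysum, Finset.sum_congr rfl fun i _ => sum_max_halfCoord (v i),
    Finset.sum_const, Finset.sum_const, Finset.card_univ, Fintype.card_prod, Fintype.card_fin,
    Fintype.card_bool, nsmul_eq_mul, nsmul_eq_mul] at hsum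
  have hXr : ∑ i ∈ X, ∑ j, |v i j| ≤ Y.card * r := by
    rw [← hYcard, ← nsmul_eq_mul]
    exact Finset.sum_le_card_nsmul _ _ _ fun i hi => hS i (Finset.sdiff_subset hi)
  have h1 := mul_le_mul_of_nonneg_left hXr
    (mul_nonneg (by positivity) (by linarith) : 0 ≤ 2 * k * (1 - 2 * l))
  -- With `L = 1 / (4 d)`, the constant term over `2 d` half axes of length `r` equals the total
  -- norm of the shrunk `Y`, so the `β` terms cancel whatever the sign of `β`.
  have e : r * (4 * k * β * L * (((d * 2 : ℕ) : ℝ) * Y.card)) = 2 * k * β * (Y.card * r) := by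
    push_cast
    linear_combination (2 * r * k * β * Y.card) * hdL
  rw [e] at hsum
  linarith

/-! ### The approximation guarantee and the existence of outputs. -/

theorem l1Dist_eq_sub {d : ℕ} (x y c : Fin d → ℝ) :
    l1Dist x y = ∑ j, |(x j - c j) - (y j - c j)| := by
  unfold l1Dist
  simp

theorem l1Dist_nonneg {d : ℕ} (x y : Fin d → ℝ) : 0 ≤ l1Dist x y :=
  Finset.sum_nonneg fun _ _ => abs_nonneg _

theorem l1Dist_self {d : ℕ} (x : Fin d → ℝ) : l1Dist x x = 0 := by simp [l1Dist]

theorem l1Dist_comm {d : ℕ} (x y : Fin d → ℝ) : l1Dist x y = l1Dist y x :=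
  Finset.sum_congr rfl fun _ _ => abs_sub_comm _ _

theorem l1Dist_triangle {d : ℕ} (x y z : Fin d → ℝ) : l1Dist x z ≤ l1Dist x y + l1Dist y z := by
  unfold l1Dist
  rw [← Finset.sum_add_distrib]
  exact Finset.sum_le_sum fun _ _ => abs_sub_le _ _ _

theorem totalDist_nonneg {n d : ℕ} (P : Fin n → Fin d → ℝ) (S : Finset (Fin n)) :
    0 ≤ totalDist P S :=
  mul_nonneg (by norm_num)
    (Finset.sum_nonneg fun _ _ => Finset.sum_nonneg fun _ _ => l1Dist_nonneg _ _)

/-- Every nonempty finite family of reals has a member that is a median. -/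
theorem exists_median {ι : Type*} (T : Finset ι) (hT : T.Nonempty) (f : ι → ℝ) :
    ∃ m ∈ T, 2 * (T.filter fun i => f m < f i).card ≤ T.card ∧
      2 * (T.filter fun i => f i < f m).card ≤ T.card := by
  classical
  obtain ⟨a, haT, ha⟩ := T.exists_max_image f hT
  have hne : (T.filter fun m => 2 * (T.filter fun i => f m < f i).card ≤ T.card).Nonempty := by
    refine ⟨a, Finset.mem_filter.2 ⟨haT, ?_⟩⟩
    rw [Finset.filter_false_of_mem fun i hi => not_lt.2 (ha i hi)]
    simp
  -- `m` has the least value with at most half of the family above it; the next smaller value `b`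
  -- has more than half above it, hence fewer than half lie below `m`.
  obtain ⟨m, hm, hmin⟩ := Finset.exists_min_image _ f hne
  rw [Finset.mem_filter] at hm
  refine ⟨m, hm.1, hm.2, ?_⟩
  by_cases hlow : (T.filter fun i => f i < f m).Nonempty
  · obtain ⟨b, hb, hbmax⟩ := Finset.exists_max_image _ f hlow
    rw [Finset.mem_filter] at hb
    have h1 : T.card < 2 * (T.filter fun i => f b < f i).card := by
      by_contra h
      exact absurd (hmin b (Finset.mem_filter.2 ⟨hb.1, not_lt.1 h⟩)) (not_le.2 hb.2)
    have h2 : (T.filter fun i => f i < f m).card ≤ (T.filter fun i => ¬ f b < f i).card := by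
      refine Finset.card_le_card fun i hi => ?_
      exact Finset.mem_filter.2 ⟨(Finset.mem_filter.1 hi).1, not_lt.2 (hbmax i hi)⟩
    have h3 := Finset.card_filter_add_card_filter_not (s := T) (fun i => f b < f i)
    omega
  · rw [Finset.not_nonempty_iff_eq_empty.1 hlow]
    simp

theorem mem_candidateMedians {n d : ℕ} (P : Fin n → Fin d → ℝ) (f : Fin d → Fin n) :
    (fun j => P (f j) j) ∈ candidateMedians P :=
  Finset.mem_image_of_mem _ (Finset.mem_univ f)

/-- A selection that is nearest to a coordinatewise median of a selection `T`. -/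
theorem totalDist_le_of_isKNearest_median {n d k : ℕ} (hd : 1 ≤ d) (P : Fin n → Fin d → ℝ)
    {c : Fin d → ℝ} {S T : Finset (Fin n)} (hS : IsKNearest P k c S) (hT : T.card = k)
    (hgt : ∀ j, 2 * (T.filter fun i => c j < P i j).card ≤ T.card)
    (hlt : ∀ j, 2 * (T.filter fun i => P i j < c j).card ≤ T.card) :
    totalDist P S ≤ (2 - 1 / (2 * (d : ℝ))) * totalDist P T := by
  have hd' : (1 : ℝ) ≤ d := by exact_mod_cast hd
  have hfac : 1 ≤ 2 - 1 / (2 * (d : ℝ)) := by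
    have : 1 / (2 * (d : ℝ)) ≤ 1 := by
      rw [div_le_one (by positivity)]; linarith
    linarith
  have hTn := totalDist_nonneg P T
  by_cases hne : S = T
  · rw [hne]; nlinarith
  have hSne : S.Nonempty := by
    rw [Finset.nonempty_iff_ne_empty]
    rintro rfl
    exact hne (Finset.card_eq_zero.1 (hT.trans (hS.1.symm.trans Finset.card_empty))).symm
  obtain ⟨a, haS, ha⟩ := S.exists_max_image (fun i => l1Dist (P i) c) hSne
  let v : Fin n → Fin d → ℝ := fun i j => P i j - c j
  have htot : ∀ U : Finset (Fin n),
      totalDist P U = 1 / 2 * ∑ i ∈ U, ∑ i' ∈ U, ∑ j, |v i j - v i' j| := fun U => by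
    unfold totalDist
    simp_rw [fun i i' => l1Dist_eq_sub (P i) (P i') c]
    rfl
  -- At radius `0` the whole selection sits at `c` and costs nothing; the layer argument needs a
  -- positive radius.
  rcases (l1Dist_nonneg (P a) c).eq_or_lt with h0 | hr
  · have : totalDist P S = 0 := by
      unfold totalDist
      rw [Finset.sum_eq_zero, mul_zero]
      refine fun i hi => Finset.sum_eq_zero fun i' hi' => le_antisymm ?_ (l1Dist_nonneg _ _)
      have h1 := ha i hi
      have h2 := ha i' hi'
      have := l1Dist_triangle (P i) c (P i')
      rw [l1Dist_comm c] at this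
      linarith
    rw [this]
    nlinarith
  · have key := sum_sum_dist_le_of_median hd S T (hS.1.trans hT.symm) hne v hr
      (fun i hi => ha i hi)
      (fun i hi => hS.2 a haS i (Finset.mem_sdiff.1 hi).2) (by
        intro h t ht
        have hcount : ∑ i ∈ T, layer (halfCoord (v i) h) t =
            ((T.filter fun i => t < halfCoord (v i) h).card : ℝ) := by
          simp [layer]
        rw [hcount]
        have : 2 * (T.filter fun i => t < halfCoord (v i) h).card ≤ T.card := by
          obtain ⟨j, b⟩ := h
          cases b
          · refine le_trans (Nat.mul_le_mul_left 2 (Finset.card_le_card fun i hi => ?_)) (hlt j)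
            simp only [halfCoord, Finset.mem_filter, v, Bool.false_eq_true, if_false] at hi ⊢
            exact ⟨hi.1, by linarith [hi.2]⟩
          · refine le_trans (Nat.mul_le_mul_left 2 (Finset.card_le_card fun i hi => ?_)) (hgt j)
            simp only [halfCoord, Finset.mem_filter, v, if_true] at hi ⊢
            exact ⟨hi.1, by linarith [hi.2]⟩
        exact_mod_cast this)
    have e : 2 - 2 * (1 / (4 * (d : ℝ))) = 2 - 1 / (2 * (d : ℝ)) := by field_simp; ring
    rw [e] at key
    rw [htot, htot]
    linarith

theorem totalDist_le_of_isMMOutput {n d k : ℕ} (hd : 1 ≤ d) (hn : 1 ≤ n)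
    (P : Fin n → Fin d → ℝ) {S T : Finset (Fin n)} (hS : IsMMOutput P k S) (hT : T.card = k) :
    totalDist P S ≤ (2 - 1 / (2 * (d : ℝ))) * totalDist P T := by
  obtain ⟨sel, hsel, c, hc, rfl, hmin⟩ := hS
  have hmed : ∃ f : Fin d → Fin n, ∀ j,
      2 * (T.filter fun i => P (f j) j < P i j).card ≤ T.card ∧
      2 * (T.filter fun i => P i j < P (f j) j).card ≤ T.card := by
    rcases T.eq_empty_or_nonempty with rfl | hTne
    · exact ⟨fun _ => ⟨0, hn⟩, by simp⟩
    · choose f _ hf using fun j : Fin d => exists_median T hTne fun i => P i j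
      exact ⟨f, hf⟩
  obtain ⟨f, hf⟩ := hmed
  have hcand := mem_candidateMedians P f
  exact (hmin _ hcand).trans (totalDist_le_of_isKNearest_median hd P (hsel _ hcand) hT
    (fun j => (hf j).1) fun j => (hf j).2)

theorem exists_isKNearest {n d k : ℕ} (P : Fin n → Fin d → ℝ) (hk : k ≤ n) (c : Fin d → ℝ) :
    ∃ S, IsKNearest P k c S := by
  have hne : (Finset.powersetCard k (Finset.univ : Finset (Fin n))).Nonempty :=
    Finset.powersetCard_nonempty.2 (by simpa using hk)
  -- A selection with minimum sum of distances to `c` is nearest, by exchanging one point.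
  obtain ⟨S, hS, hmin⟩ := Finset.exists_min_image _ (fun S => ∑ i ∈ S, l1Dist (P i) c) hne
  have hcard := (Finset.mem_powersetCard.1 hS).2
  refine ⟨S, hcard, fun i hi j hj => ?_⟩
  have hj' : j ∉ S.erase i := fun h => hj (Finset.mem_of_mem_erase h)
  have h := hmin (insert j (S.erase i)) (Finset.mem_powersetCard.2 ⟨Finset.subset_univ _, by
    rw [Finset.card_insert_of_notMem hj', Finset.card_erase_add_one hi, hcard]⟩)
  simp only [Finset.sum_insert hj'] at h
  rw [← Finset.add_sum_erase S _ hi] at h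
  linarith

theorem candidateMedians_nonempty {n d : ℕ} (hn : 1 ≤ n) (P : Fin n → Fin d → ℝ) :
    (candidateMedians P).Nonempty :=
  ⟨_, mem_candidateMedians P fun _ => ⟨0, hn⟩⟩

theorem card_candidateMedians_le {n d : ℕ} (P : Fin n → Fin d → ℝ) :
    (candidateMedians P).card ≤ n ^ d :=
  Finset.card_image_le.trans (by simp)

theorem exists_isMMOutput {n d k : ℕ} (hn : 1 ≤ n) (P : Fin n → Fin d → ℝ) (hk : k ≤ n) :
    ∃ S, IsMMOutput P k S := by
  choose sel hsel using exists_isKNearest P hk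
  obtain ⟨c, hc, hmin⟩ := Finset.exists_min_image _ (fun c => totalDist P (sel c))
    (candidateMedians_nonempty hn P)
  exact ⟨sel c, sel, fun c _ => hsel c, c, hc, rfl, hmin⟩

theorem IsMMOutput.card_eq {n d k : ℕ} {P : Fin n → Fin d → ℝ} {S : Finset (Fin n)}
    (hS : IsMMOutput P k S) : S.card = k := by
  obtain ⟨sel, hsel, c, hc, rfl, -⟩ := hS
  exact (hsel c hc).1

theorem exists_isOptimal {n d k : ℕ} (P : Fin n → Fin d → ℝ) (hk : k ≤ n) :
    ∃ T, IsOptimal P k T := by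
  have hne : (Finset.powersetCard k (Finset.univ : Finset (Fin n))).Nonempty :=
    Finset.powersetCard_nonempty.2 (by simpa using hk)
  obtain ⟨T, hT, hmin⟩ := Finset.exists_min_image _ (totalDist P) hne
  exact ⟨T, (Finset.mem_powersetCard.1 hT).2, fun T' hT' =>
    hmin T' (Finset.mem_powersetCard.2 ⟨Finset.subset_univ _, hT'⟩)⟩

theorem totalDist_pos {n d : ℕ} {P : Fin n → Fin d → ℝ} (hP : Function.Injective P)
    {T : Finset (Fin n)} (hT : 1 < T.card) : 0 < totalDist P T := by
  obtain ⟨a, ha, b, hb, hab⟩ := Finset.one_lt_card.1 hT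
  have h : 0 < l1Dist (P a) (P b) := by
    refine (l1Dist_nonneg _ _).lt_of_ne fun h => hab (hP (funext fun j => ?_))
    have := (Finset.sum_eq_zero_iff_of_nonneg fun j _ => abs_nonneg _).1 h.symm j
      (Finset.mem_univ j)
    exact sub_eq_zero.1 (abs_eq_zero.1 this)
  refine mul_pos (by norm_num) (Finset.sum_pos' (fun _ _ => Finset.sum_nonneg fun _ _ =>
    l1Dist_nonneg _ _) ⟨a, ha, Finset.sum_pos' (fun _ _ => l1Dist_nonneg _ _) ⟨b, hb, h⟩⟩)

/-! ### The geometry of the tight instance. -/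

/-- The half axes other than the first positive one. -/
abbrev SideDirection (m : ℕ) : Type := {h : Fin (m + 1) × Bool // h ≠ (0, true)}

/-- Labels of the points of the tight instance: two mirror images of a cluster of `2 (m + 1)`
points with one satellite for every half axis that does not point to the other cluster. -/
abbrev TightLabel (m : ℕ) : Type := Bool × (Fin (2 * (m + 1)) ⊕ SideDirection m)

/-- The reflection that exchanges the origin and the first unit vector. -/
def mirror {m : ℕ} (x : Fin (m + 1) → ℝ) : Fin (m + 1) → ℝ := Fin.cons (1 - x 0) fun j => x j.succ

/-- The cluster at the origin and its satellites at distance `δ`. -/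
def clusterPoint {m : ℕ} (δ : ℝ) : Fin (2 * (m + 1)) ⊕ SideDirection m → Fin (m + 1) → ℝ
  | .inl _ => 0
  | .inr h => Pi.single h.1.1 (if h.1.2 then δ else -δ)

/-- The points of the tight instance before perturbation. -/
def tightPoint {m : ℕ} (δ : ℝ) (i : TightLabel m) : Fin (m + 1) → ℝ :=
  if i.1 then mirror (clusterPoint δ i.2) else clusterPoint δ i.2

theorem l1Dist_mirror_mirror {m : ℕ} (x y : Fin (m + 1) → ℝ) :
    l1Dist (mirror x) (mirror y) = l1Dist x y := by
  simp only [l1Dist, mirror, Fin.sum_univ_succ, Fin.cons_zero, Fin.cons_succ]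
  rw [abs_sub_comm (x 0)]
  ring_nf

theorem l1Dist_mirror_left {m : ℕ} (x y : Fin (m + 1) → ℝ) :
    l1Dist (mirror x) y = l1Dist x (mirror y) := by
  simp only [l1Dist, mirror, Fin.sum_univ_succ, Fin.cons_zero, Fin.cons_succ]
  rw [← abs_neg]
  ring_nf

theorem l1Dist_zero_mirror {m : ℕ} {x : Fin (m + 1) → ℝ} (hx : x 0 ≤ 0) :
    l1Dist 0 (mirror x) = 1 + l1Dist 0 x := by
  simp only [l1Dist, mirror, Fin.sum_univ_succ, Fin.cons_zero, Fin.cons_succ, Pi.zero_apply]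
  rw [abs_of_nonpos (by linarith), abs_of_nonneg (by linarith)]
  ring

theorem one_le_l1Dist_mirror {m : ℕ} {x y : Fin (m + 1) → ℝ} (hx : x 0 ≤ 0) (hy : y 0 ≤ 0) :
    1 ≤ l1Dist x (mirror y) := by
  have h : |x 0 - mirror y 0| ≤ l1Dist x (mirror y) :=
    Finset.single_le_sum (f := fun j => |x j - mirror y j|) (fun _ _ => abs_nonneg _)
      (Finset.mem_univ _)
  refine le_trans ?_ h
  simp only [mirror, Fin.cons_zero]
  rw [abs_of_nonpos (by linarith)]
  linarith

theorem clusterPoint_zero_le {m : ℕ} {δ : ℝ} (hδ : 0 ≤ δ)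
    (u : Fin (2 * (m + 1)) ⊕ SideDirection m) : clusterPoint δ u 0 ≤ 0 := by
  rcases u with a | ⟨⟨j, σ⟩, h⟩
  · exact le_rfl
  · by_cases hj : j = 0
    · subst hj
      cases σ
      · simpa [clusterPoint] using hδ
      · exact absurd rfl h
    · simp [clusterPoint, Pi.single_eq_of_ne (Ne.symm hj)]

theorem l1Dist_clusterPoint_inl_inr {m : ℕ} {δ : ℝ} (hδ : 0 ≤ δ) (a : Fin (2 * (m + 1)))
    (h : SideDirection m) : l1Dist (clusterPoint δ (.inl a)) (clusterPoint δ (.inr h)) = δ := by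
  unfold l1Dist
  rw [Finset.sum_eq_single h.1.1]
  · simp only [clusterPoint, Pi.zero_apply, Pi.single_eq_same, zero_sub, abs_neg]
    split_ifs <;> simp [abs_of_nonneg hδ]
  · intro j _ hj
    simp [clusterPoint, Pi.single_eq_of_ne hj]
  · simp

theorem l1Dist_clusterPoint_inr_inr {m : ℕ} {δ : ℝ} (hδ : 0 ≤ δ) {h h' : SideDirection m}
    (hne : h ≠ h') :
    2 * δ ≤ l1Dist (clusterPoint δ (.inr h)) (clusterPoint δ (.inr h')) := by
  obtain ⟨⟨j, σ⟩, hh⟩ := h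
  obtain ⟨⟨j', σ'⟩, hh'⟩ := h'
  by_cases hj : j = j'
  · subst hj
    have hσ : σ ≠ σ' := fun e => hne (by subst e; rfl)
    refine le_trans ?_ (Finset.single_le_sum (fun _ _ => abs_nonneg _) (Finset.mem_univ j))
    simp only [clusterPoint, Pi.single_eq_same]
    cases σ <;> cases σ' <;> first | exact absurd rfl hσ | skip
    · simp only [Bool.false_eq_true, if_false, if_true]
      rw [abs_of_nonpos (by linarith)]; linarith
    · simp only [Bool.false_eq_true, if_false, if_true]
      rw [abs_of_nonneg (by linarith)]; linarith
  · refine le_trans (le_of_eq ?_) (Finset.sum_le_sum_of_subset_of_nonneg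
      (Finset.subset_univ {j, j'}) fun _ _ _ => abs_nonneg _)
    rw [Finset.sum_pair hj]
    simp only [clusterPoint, Pi.single_eq_same, Pi.single_eq_of_ne hj,
      Pi.single_eq_of_ne (Ne.symm hj), sub_zero, zero_sub, abs_neg]
    split_ifs <;> simp [abs_of_nonneg hδ] <;> ring

theorem l1Dist_tightPoint_same {m : ℕ} (δ : ℝ) (b : Bool)
    (u v : Fin (2 * (m + 1)) ⊕ SideDirection m) :
    l1Dist (tightPoint δ (b, u)) (tightPoint δ (b, v)) =
      l1Dist (clusterPoint δ u) (clusterPoint δ v) := by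
  cases b
  · rfl
  · exact l1Dist_mirror_mirror _ _

theorem l1Dist_tightPoint_not {m : ℕ} (δ : ℝ) (b : Bool)
    (u v : Fin (2 * (m + 1)) ⊕ SideDirection m) :
    l1Dist (tightPoint δ (b, u)) (tightPoint δ (!b, v)) =
      l1Dist (clusterPoint δ u) (mirror (clusterPoint δ v)) := by
  cases b
  · rfl
  · exact l1Dist_mirror_left _ _

/-! ### The cost of a nearest selection in the tight instance. -/

/-- A lower bound for the pairwise sum over a cluster `A` and a set `U` of scattered points. -/
theorem le_sum_sum_union {ι : Type*} [DecidableEq ι] (D : ι → ι → ℝ)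
    (hsymm : ∀ i j, D i j = D j i) (hD : ∀ i j, 0 ≤ D i j) {A U : Finset ι} (hAU : Disjoint A U)
    {N : ℕ} (hN : 1 ≤ N) (hA : A.card = N) (hU : U.card = N) {δ : ℝ} (g : ι → ℝ)
    (hg : ∀ i, 0 ≤ g i) (h1 : ∀ a ∈ A, ∀ u ∈ U, δ + g u ≤ D a u)
    (h2 : ∀ u ∈ U, ∀ v ∈ U, u ≠ v → 2 * δ - g u - g v ≤ D u v) :
    δ * (4 * N ^ 2 - 2 * N) ≤ ∑ i ∈ A ∪ U, ∑ j ∈ A ∪ U, D i j := by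
  have hN' : (1 : ℝ) ≤ N := by exact_mod_cast hN
  have hG : 0 ≤ ∑ u ∈ U, g u := Finset.sum_nonneg fun u _ => hg u
  have eAU : N * (N * δ + ∑ u ∈ U, g u) ≤ ∑ a ∈ A, ∑ u ∈ U, D a u := by
    calc N * (N * δ + ∑ u ∈ U, g u) = ∑ a ∈ A, ∑ u ∈ U, (δ + g u) := by
          simp [Finset.sum_add_distrib, hA, hU]
          ring
      _ ≤ _ := Finset.sum_le_sum fun a ha => Finset.sum_le_sum fun u hu => h1 a ha u hu
  have eUA : ∑ u ∈ U, ∑ a ∈ A, D u a = ∑ a ∈ A, ∑ u ∈ U, D a u := by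
    rw [Finset.sum_comm]
    exact Finset.sum_congr rfl fun _ _ => Finset.sum_congr rfl fun _ _ => hsymm _ _
  have eAA : 0 ≤ ∑ a ∈ A, ∑ u ∈ A, D a u :=
    Finset.sum_nonneg fun _ _ => Finset.sum_nonneg fun _ _ => hD _ _
  have eUU : 2 * δ * (N * (N - 1)) - 2 * (N - 1) * ∑ u ∈ U, g u ≤ ∑ u ∈ U, ∑ v ∈ U, D u v := by
    calc 2 * δ * (N * (N - 1)) - 2 * (N - 1) * ∑ u ∈ U, g u
        = ∑ u ∈ U, ((∑ v ∈ U, (2 * δ - g u - g v)) - (2 * δ - g u - g u)) := by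
          simp only [Finset.sum_sub_distrib, Finset.sum_const, nsmul_eq_mul, hU, ← Finset.mul_sum]
          ring
      _ ≤ _ := Finset.sum_le_sum fun u hu => by
          rw [← Finset.add_sum_erase U _ hu, ← Finset.add_sum_erase U (D u) hu]
          have : ∑ v ∈ U.erase u, (2 * δ - g u - g v) ≤ ∑ v ∈ U.erase u, D u v :=
            Finset.sum_le_sum fun v hv =>
              h2 u hu v (Finset.mem_of_mem_erase hv) (Finset.ne_of_mem_erase hv).symm
          linarith [hD u u]
  simp only [Finset.sum_union hAU, Finset.sum_add_distrib]
  rw [eUA]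
  -- Each `g u` is gained on `N` pairs with `A` and lost on at most `N - 1` pairs inside `U`, so the
  -- net effect is nonnegative.
  nlinarith

theorem card_sideDirection (m : ℕ) : Fintype.card (SideDirection m) = 2 * m + 1 := by
  rw [Fintype.card_subtype_compl, Fintype.card_subtype_eq]
  simp
  omega

/-- A selection nearest to a point that is closer to the cluster `b` than to the other one. -/
theorem le_sum_sum_of_nearest_side {m : ℕ} {δ : ℝ} (hδ : 0 < δ) (hδ1 : δ < 1) (b : Bool)
    (c : Fin (m + 1) → ℝ)
    (hc : ∀ a a', l1Dist (tightPoint (m := m) δ (!b, .inl a')) c =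
      l1Dist (tightPoint (m := m) δ (b, .inl a)) c + 1)
    {S : Finset (TightLabel m)} (hcard : S.card = 4 * (m + 1))
    (hS : ∀ i ∈ S, ∀ j ∉ S, l1Dist (tightPoint δ i) c ≤ l1Dist (tightPoint δ j) c) :
    δ * (4 * ((2 * (m + 1) : ℕ) : ℝ) ^ 2 - 2 * ((2 * (m + 1) : ℕ) : ℝ)) ≤
      ∑ i ∈ S, ∑ j ∈ S, l1Dist (tightPoint δ i) (tightPoint δ j) := by
  classical
  have hsat : ∀ b' a h,
      l1Dist (tightPoint (m := m) δ (b', .inl a)) (tightPoint δ (b', .inr h)) = δ := fun b' a h => by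
    rw [l1Dist_tightPoint_same, l1Dist_clusterPoint_inl_inr hδ.le]
  have near : ∀ a u, l1Dist (tightPoint (m := m) δ (b, u)) c ≤
      l1Dist (tightPoint (m := m) δ (b, .inl a)) c + δ := by
    intro a u
    rcases u with a' | h
    · have h1 := hc a a
      have h2 := hc a' a
      linarith
    · have := l1Dist_triangle (tightPoint δ (b, .inr h)) (tightPoint δ (b, .inl a)) c
      rw [l1Dist_comm _ (tightPoint δ (b, .inl a)), hsat] at this
      linarith
  have far : ∀ a u, l1Dist (tightPoint (m := m) δ (b, .inl a)) c <
      l1Dist (tightPoint (m := m) δ (!b, u)) c := by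
    intro a u
    rcases u with a' | h
    · linarith [hc a a']
    · have := l1Dist_triangle (tightPoint δ (!b, .inl a)) (tightPoint δ (!b, .inr h)) c
      rw [hsat] at this
      linarith [hc a a]
  -- `F`, the near cluster with its satellites, has `k - 1` points. So `S` contains a far point,
  -- which forces the whole near cluster `A` into `S`; two far cluster points would force `F` too,
  -- giving `k + 1` points.
  let F : Finset (TightLabel m) := Finset.univ.image fun u => (b, u)
  let A : Finset (TightLabel m) := Finset.univ.image fun a => (b, Sum.inl a)
  have hF : F.card = 4 * (m + 1) - 1 := by
    rw [Finset.card_image_of_injective _ (fun u v h => (Prod.ext_iff.1 h).2), Finset.card_univ,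
      Fintype.card_sum, card_sideDirection, Fintype.card_fin]
    omega
  have hA : A.card = 2 * (m + 1) := by
    rw [Finset.card_image_of_injective _ (fun u v h => Sum.inl_injective (Prod.ext_iff.1 h).2),
      Finset.card_univ, Fintype.card_fin]
  have hAS : A ⊆ S := by
    intro i hi
    obtain ⟨a, -, rfl⟩ := Finset.mem_image.1 hi
    by_contra hnot
    have : S ⊆ F := by
      rintro ⟨b', u⟩ hu
      rcases Bool.eq_or_eq_not b' b with rfl | rfl
      · exact Finset.mem_image_of_mem _ (Finset.mem_univ u)
      · exact absurd (hS _ hu _ hnot) (not_le.2 (far a u))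
    have := Finset.card_le_card this
    omega
  have honce : ∀ x y, (!b, Sum.inl x) ∈ S → (!b, Sum.inl y) ∈ S → x = y := by
    intro x y hx hy
    by_contra hxy
    have hFS : F ⊆ S := by
      intro i hi
      obtain ⟨u, -, rfl⟩ := Finset.mem_image.1 hi
      by_contra hnot
      linarith [hS _ hx _ hnot, near x u, hc x x]
    have hsub : F ∪ {(!b, Sum.inl x), (!b, Sum.inl y)} ⊆ S := by
      refine Finset.union_subset hFS fun i hi => ?_
      rcases Finset.mem_insert.1 hi with rfl | hi
      · exact hx
      · rw [Finset.mem_singleton.1 hi]; exact hy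
    have hdisj : Disjoint F {(!b, Sum.inl x), (!b, Sum.inl y)} := by
      rw [Finset.disjoint_left]
      intro i hi hi'
      obtain ⟨u, -, rfl⟩ := Finset.mem_image.1 hi
      simp at hi'
    have := Finset.card_le_card hsub
    rw [Finset.card_union_of_disjoint hdisj, Finset.card_pair (by simpa using hxy)] at this
    omega
  -- `S` may also contain far satellites. They can be closer than `2 * δ` to other scattered points,
  -- but are at distance `1 + δ` from `A`; `g` records this surplus of `1`.
  let g : TightLabel m → ℝ := fun i => if i.1 = b then 0 else Sum.elim (fun _ => 0) (fun _ => 1) i.2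
  have hgsame : ∀ u, g (b, u) = 0 := fun u => if_pos rfl
  have hginl : ∀ a, g (!b, .inl a) = 0 := fun a => by simp [g]
  have hginr : ∀ h, g (!b, .inr h) = 1 := fun h => by simp [g]
  have hU : (S \ A).card = 2 * (m + 1) := by
    rw [Finset.card_sdiff_of_subset hAS, hcard, hA]
    omega
  have hcp := clusterPoint_zero_le (m := m) hδ.le
  have key := le_sum_sum_union (fun i j => l1Dist (tightPoint (m := m) δ i) (tightPoint δ j))
    (fun _ _ => l1Dist_comm _ _) (fun _ _ => l1Dist_nonneg _ _) (A := A) (U := S \ A)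
    Finset.disjoint_sdiff (N := 2 * (m + 1)) (by omega) hA hU (δ := δ) g ?_ ?_ ?_
  · rwa [Finset.union_sdiff_of_subset hAS] at key
  · rintro ⟨b', u⟩
    rcases Bool.eq_or_eq_not b' b with rfl | rfl
    · exact (hgsame _).ge
    · rcases u with a | h
      · exact (hginl _).ge
      · rw [hginr]; exact zero_le_one
  · intro i hi ⟨b', u⟩ hu
    obtain ⟨a, -, rfl⟩ := Finset.mem_image.1 hi
    rcases Bool.eq_or_eq_not b' b with rfl | rfl
    · rcases u with a' | h
      · exact absurd (Finset.mem_image_of_mem _ (Finset.mem_univ a')) (Finset.mem_sdiff.1 hu).2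
      · rw [hgsame, hsat, add_zero]
    · rw [l1Dist_tightPoint_not]
      have e : l1Dist (clusterPoint δ (.inl a)) (mirror (clusterPoint δ u)) =
        1 + l1Dist (clusterPoint δ (.inl a)) (clusterPoint δ u) := l1Dist_zero_mirror (hcp u)
      rw [e]
      rcases u with a' | h
      · rw [hginl]; linarith [l1Dist_nonneg (clusterPoint (m := m) δ (.inl a)) (clusterPoint δ (.inl a'))]
      · rw [hginr, l1Dist_clusterPoint_inl_inr hδ.le, add_comm]
  · have hinr : ∀ b' h u, (b', u) ∈ S \ A → ((b', Sum.inr h) : TightLabel m) ≠ (b', u) →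
        2 * δ - g (b', .inr h) - g (b', u) ≤
          l1Dist (tightPoint (m := m) δ (b', .inr h)) (tightPoint δ (b', u)) := by
      intro b' h u hu hne
      rcases u with a | h'
      · rw [l1Dist_comm, hsat]
        rcases Bool.eq_or_eq_not b' b with rfl | rfl
        · exact absurd (Finset.mem_image_of_mem _ (Finset.mem_univ a)) (Finset.mem_sdiff.1 hu).2
        · rw [hginl, hginr]; linarith
      · have := l1Dist_clusterPoint_inr_inr hδ.le (h := h) (h' := h') fun e => hne (by rw [e])
        rw [l1Dist_tightPoint_same]
        rcases Bool.eq_or_eq_not b' b with rfl | rfl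
        · rw [hgsame, hgsame]; linarith
        · rw [hginr, hginr]; linarith
    have hcross : ∀ u v, (b, u) ∈ S \ A →
        2 * δ - g (b, u) - g (!b, v) ≤
          l1Dist (tightPoint (m := m) δ (b, u)) (tightPoint δ (!b, v)) := by
      intro u v hu
      rw [l1Dist_tightPoint_not, hgsame]
      rcases u with a | h
      · exact absurd (Finset.mem_image_of_mem _ (Finset.mem_univ a)) (Finset.mem_sdiff.1 hu).2
      rcases v with a' | h'
      · have e : l1Dist (clusterPoint δ (.inr h)) (mirror (clusterPoint δ (.inl a'))) =
            1 + l1Dist (clusterPoint δ (.inl a')) (clusterPoint δ (.inr h)) := by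
          rw [← l1Dist_mirror_left, l1Dist_comm]
          exact l1Dist_zero_mirror (hcp _)
        rw [e, hginl, l1Dist_clusterPoint_inl_inr hδ.le]
        linarith
      · rw [hginr]
        linarith [one_le_l1Dist_mirror (hcp (.inr h)) (hcp (.inr h'))]
    rintro ⟨b₁, u⟩ hu ⟨b₂, v⟩ hv hne
    rcases Bool.eq_or_eq_not b₁ b₂ with rfl | hb
    · rcases u with a | h
      · rcases v with a' | h'
        · rcases Bool.eq_or_eq_not b₁ b with rfl | rfl
          · exact absurd (Finset.mem_image_of_mem _ (Finset.mem_univ a)) (Finset.mem_sdiff.1 hu).2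
          · exact absurd (by rw [honce a a' (Finset.mem_sdiff.1 hu).1 (Finset.mem_sdiff.1 hv).1])
              hne
        · have := hinr b₁ h' _ hu hne.symm
          rw [l1Dist_comm]
          linarith
      · exact hinr b₁ h v hv hne
    · rcases Bool.eq_or_eq_not b₁ b with rfl | rfl
      · obtain rfl : b₂ = !b₁ := by rw [hb, Bool.not_not]
        exact hcross u v hu
      · obtain rfl : b₂ = b := by simpa using hb.symm
        have := hcross v u hv
        rw [l1Dist_comm]
        linarith

theorem l1Dist_mirror_zero {m : ℕ} {c : Fin (m + 1) → ℝ} (hc : c 0 ≤ 0) :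
    l1Dist (mirror 0) c = l1Dist 0 c + 1 := by
  rw [l1Dist_mirror_left, l1Dist_zero_mirror hc, add_comm]

theorem exists_nearer_side {m : ℕ} {δ : ℝ} {c : Fin (m + 1) → ℝ} (hc : c 0 ≤ 0 ∨ 1 ≤ c 0) :
    ∃ b : Bool, ∀ a a', l1Dist (tightPoint (m := m) δ (!b, .inl a')) c =
      l1Dist (tightPoint (m := m) δ (b, .inl a)) c + 1 := by
  rcases hc with hc | hc
  · exact ⟨false, fun _ _ => l1Dist_mirror_zero hc⟩
  · refine ⟨true, fun _ _ => ?_⟩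
    have h : mirror c 0 ≤ 0 := by simpa [mirror] using hc
    have := l1Dist_mirror_zero h
    rw [l1Dist_mirror_mirror, ← l1Dist_mirror_left] at this
    exact this

/-- No satellite points towards the other cluster, so the open slab between the clusters contains no
input coordinate and hence no candidate median. -/
theorem tightPoint_zero {m : ℕ} {δ : ℝ} (hδ : 0 ≤ δ) (i : TightLabel m) :
    tightPoint δ i 0 ≤ 0 ∨ 1 ≤ tightPoint δ i 0 := by
  obtain ⟨b, u⟩ := i
  have h := clusterPoint_zero_le hδ u
  cases b
  · exact Or.inl h
  · refine Or.inr ?_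
    simp only [tightPoint, if_true, mirror, Fin.cons_zero]
    linarith

theorem totalDist_comp_equiv {n d : ℕ} {ι : Type*} (e : Fin n ≃ ι) (Q : ι → Fin d → ℝ)
    (S : Finset (Fin n)) :
    totalDist (Q ∘ e) S = 1 / 2 * ∑ i ∈ S.map e.toEmbedding, ∑ j ∈ S.map e.toEmbedding,
      l1Dist (Q i) (Q j) := by
  simp [totalDist, Finset.sum_map]

/-- Both clusters of the tight instance, without the satellites. -/
def clusterLabels (m : ℕ) : Finset (TightLabel m) :=
  Finset.univ.map ((Function.Embedding.refl Bool).prodMap Function.Embedding.inl)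

theorem card_clusterLabels (m : ℕ) : (clusterLabels m).card = 4 * (m + 1) := by
  simp [clusterLabels]
  ring

theorem sum_sum_clusterLabels (m : ℕ) (δ : ℝ) :
    ∑ i ∈ clusterLabels m, ∑ j ∈ clusterLabels m, l1Dist (tightPoint δ i) (tightPoint δ j) =
      2 * ((2 * (m + 1) : ℕ) : ℝ) ^ 2 := by
  have h0 : ∀ b a a', l1Dist (tightPoint (m := m) δ (b, .inl a)) (tightPoint δ (b, .inl a')) = 0 :=
    fun b a a' => by rw [l1Dist_tightPoint_same]; exact l1Dist_self _
  have h1 : ∀ a a', l1Dist (tightPoint (m := m) δ (true, .inl a)) (tightPoint δ (false, .inl a')) =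
      1 := fun a a' => by
    have := l1Dist_mirror_zero (m := m) (c := 0) le_rfl
    rw [l1Dist_self, zero_add] at this
    exact this
  have h2 : ∀ a a', l1Dist (tightPoint (m := m) δ (false, .inl a)) (tightPoint δ (true, .inl a')) =
      1 := fun a a' => by rw [l1Dist_comm, h1]
  simp only [clusterLabels, Finset.sum_map, Fintype.sum_prod_type, Fintype.sum_bool,
    Function.Embedding.coe_prodMap, Function.Embedding.refl_apply, Prod.map_apply,
    Function.Embedding.inl_apply, h0, h1, h2]
  simp
  ring

theorem le_totalDist_tightPoint {m n : ℕ} {δ : ℝ} (hδ : 0 < δ) (hδ1 : δ < 1)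
    (e : Fin n ≃ TightLabel m) (f : Fin (m + 1) → Fin n) {S : Finset (Fin n)}
    (hS : IsKNearest (tightPoint δ ∘ e) (4 * (m + 1))
      (fun j => (tightPoint δ ∘ e) (f j) j) S) :
    δ * (2 * ((2 * (m + 1) : ℕ) : ℝ) ^ 2 - ((2 * (m + 1) : ℕ) : ℝ)) ≤
      totalDist (tightPoint δ ∘ e) S := by
  obtain ⟨b, hb⟩ := exists_nearer_side (δ := δ) (c := fun j => (tightPoint δ ∘ e) (f j) j)
    (tightPoint_zero hδ.le (e (f 0)))
  have := le_sum_sum_of_nearest_side hδ hδ1 b _ hb (S := S.map e.toEmbedding)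
    (by rw [Finset.card_map, hS.1]) (by
      intro i hi j hj
      have hi' : e.symm i ∈ S := by simpa [Finset.mem_map_equiv] using hi
      have hj' : e.symm j ∉ S := by simpa [Finset.mem_map_equiv] using hj
      simpa using hS.2 _ hi' _ hj')
  rw [totalDist_comp_equiv]
  linarith

/-! ### Perturbation to distinct points, and the conclusion. -/

theorem continuous_l1Dist {d : ℕ} {x y : ℝ → Fin d → ℝ} (hx : ∀ j, Continuous fun t => x t j)
    (hy : ∀ j, Continuous fun t => y t j) : Continuous fun t => l1Dist (x t) (y t) :=
  continuous_finsetSum _ fun j _ => ((hx j).sub (hy j)).abs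

/-- A strict lower bound for the nearest selections survives small perturbations. -/
theorem eventually_lt_totalDist_of_isKNearest {n d k : ℕ} (P : ℝ → Fin n → Fin d → ℝ)
    (hP : ∀ i j, Continuous fun t => P t i j) (ρ : ℝ) (T : Finset (Fin n))
    (h : ∀ (f : Fin d → Fin n) S, IsKNearest (P 0) k (fun j => P 0 (f j) j) S →
      ρ * totalDist (P 0) T < totalDist (P 0) S) :
    ∀ᶠ t in 𝓝 0, ∀ (f : Fin d → Fin n) S, IsKNearest (P t) k (fun j => P t (f j) j) S →
      ρ * totalDist (P t) T < totalDist (P t) S := by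
  have htot : ∀ S, Continuous fun t => totalDist (P t) S := fun S =>
    continuous_const.mul (continuous_finsetSum _ fun i _ => continuous_finsetSum _ fun j _ =>
      continuous_l1Dist (hP i) (hP j))
  refine eventually_all.2 fun f => eventually_all.2 fun S => ?_
  by_cases hS : IsKNearest (P 0) k (fun j => P 0 (f j) j) S
  · have := (continuous_const.mul (htot T)).continuousAt.eventually_lt (htot S).continuousAt
      (h f S hS)
    filter_upwards [this] with t ht _ using ht
  -- Failing to be nearest is witnessed by a strict inequality, hence is an open condition: no new
  -- nearest selections appear for small `t`.
  · by_cases hk : S.card = k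
    · obtain ⟨i, hi, j, hj, hij⟩ : ∃ i ∈ S, ∃ j ∉ S,
          l1Dist (P 0 j) (fun j => P 0 (f j) j) < l1Dist (P 0 i) (fun j => P 0 (f j) j) := by
        by_contra! hcon
        exact hS ⟨hk, hcon⟩
      have hc : ∀ i, Continuous fun t => l1Dist (P t i) (fun j => P t (f j) j) := fun i =>
        continuous_l1Dist (hP i) fun j => hP (f j) j
      filter_upwards [(hc j).continuousAt.eventually_lt (hc i).continuousAt hij] with t ht hS'
      exact absurd (hS'.2 i hi j hj) (not_le.2 ht)
    · exact Eventually.of_forall fun t hS' => absurd hS'.1 hk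

theorem eventually_injective_perturbation {n m : ℕ} (Q : Fin n → Fin (m + 1) → ℝ) :
    ∀ᶠ t : ℝ in 𝓝[>] 0,
      Function.Injective fun i => Q i + Pi.single (0 : Fin (m + 1)) (t * (i : ℝ)) := by
  have : ∀ i i' : Fin n, ∀ᶠ t : ℝ in 𝓝[>] 0, i ≠ i' → Q i 0 + t * i ≠ Q i' 0 + t * i' := by
    intro i i'
    by_cases hQ : Q i 0 = Q i' 0
    · filter_upwards [self_mem_nhdsWithin] with t ht hne heq
      rw [hQ, add_right_inj] at heq
      exact hne (Fin.ext (by exact_mod_cast mul_left_cancel₀ (ne_of_gt ht) heq))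
    · have h1 : ContinuousAt (fun t : ℝ => Q i 0 + t * i - (Q i' 0 + t * i')) 0 := by fun_prop
      have h2 := h1.eventually_ne (y := 0) (by simpa [sub_eq_zero] using hQ)
      filter_upwards [nhdsWithin_le_nhds h2] with t ht _ heq
      exact ht (sub_eq_zero.2 heq)
  filter_upwards [eventually_all.2 fun i => eventually_all.2 fun i' => this i i'] with t ht i i' heq
  by_contra hne
  exact ht i i' hne (by simpa using congrFun heq 0)

theorem exists_isMMOutput_gt (m : ℕ) (ρ : ℝ) (hρ : ρ < 2 - 1 / (2 * ((m + 1 : ℕ) : ℝ))) :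
    ∃ (n k : ℕ) (P : Fin n → Fin (m + 1) → ℝ), 1 ≤ n ∧ k ≤ n ∧ Function.Injective P ∧
      ∃ T : Finset (Fin n), IsOptimal P k T ∧ 0 < totalDist P T ∧
        ∀ S : Finset (Fin n), IsMMOutput P k S → ρ * totalDist P T < totalDist P S := by
  set N : ℝ := ((2 * (m + 1) : ℕ) : ℝ) with hN
  have hN2 : 2 ≤ N := by rw [hN]; exact_mod_cast (by omega : 2 ≤ 2 * (m + 1))
  -- A nonnegative factor is needed because the optimum is only bounded above, by the cost of the
  -- two clusters.
  have hρN : max ρ 0 < 2 - 1 / N := by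
    refine max_lt (by rw [hN]; push_cast at hρ ⊢; exact hρ) ?_
    have : 1 / N ≤ 1 := by rw [div_le_one (by linarith)]; linarith
    linarith
  have hden : 0 < 2 * N ^ 2 - N := by nlinarith
  have hlt : max ρ 0 * N ^ 2 / (2 * N ^ 2 - N) < 1 := by
    rw [div_lt_one hden]
    calc max ρ 0 * N ^ 2 < (2 - 1 / N) * N ^ 2 := mul_lt_mul_of_pos_right hρN (by positivity)
      _ = 2 * N ^ 2 - N := by field_simp
  obtain ⟨δ, hδρ, hδ1⟩ := exists_between hlt
  have hδ : 0 < δ := lt_of_le_of_lt (by positivity) hδρ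
  rw [div_lt_iff₀ hden] at hδρ
  let e : Fin (Fintype.card (TightLabel m)) ≃ TightLabel m := (Fintype.equivFin _).symm
  let T₀ := (clusterLabels m).map e.symm.toEmbedding
  have hT₀ : T₀.card = 4 * (m + 1) := by rw [Finset.card_map, card_clusterLabels]
  let P : ℝ → Fin (Fintype.card (TightLabel m)) → Fin (m + 1) → ℝ := fun t i =>
    tightPoint δ (e i) + Pi.single 0 (t * (i : ℝ))
  have hP0 : P 0 = tightPoint δ ∘ e := by
    funext i
    simp [P]
  have hPc : ∀ i j, Continuous fun t => P t i j := by
    intro i j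
    refine continuous_const.add ?_
    by_cases hj : j = 0
    · subst hj
      simp only [Pi.single_eq_same]
      fun_prop
    · simp only [Pi.single_eq_of_ne hj]
      exact continuous_const
  have hev := eventually_lt_totalDist_of_isKNearest (k := 4 * (m + 1)) P hPc (max ρ 0) T₀ (by
    intro f S hS
    rw [hP0] at hS ⊢
    refine lt_of_lt_of_le ?_ (le_totalDist_tightPoint hδ hδ1 e f hS)
    have : T₀.map e.toEmbedding = clusterLabels m := by
      rw [Finset.map_map]
      ext i
      simp
    rw [totalDist_comp_equiv, this, sum_sum_clusterLabels]
    linarith)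
  obtain ⟨t, ht, hinj⟩ := ((hev.filter_mono nhdsWithin_le_nhds).and
    (eventually_injective_perturbation (tightPoint δ ∘ e))).exists
  have hk : 4 * (m + 1) ≤ Fintype.card (TightLabel m) := by
    rw [← card_clusterLabels]
    exact Finset.card_le_univ _
  obtain ⟨T, hT⟩ := exists_isOptimal (P t) hk
  have hpos : 0 < totalDist (P t) T := totalDist_pos hinj (by rw [hT.1]; omega)
  refine ⟨_, 4 * (m + 1), P t, by omega, hk, hinj, T, hT, hpos, ?_⟩
  -- The choice of the best candidate is irrelevant: every nearest selection of every candidate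
  -- median is expensive.
  rintro S ⟨sel, hsel, c, hc, rfl, -⟩
  have hnear := hsel c hc
  obtain ⟨f, -, hf⟩ := Finset.mem_image.1 hc
  rw [← hf] at hnear ⊢
  calc ρ * totalDist (P t) T ≤ max ρ 0 * totalDist (P t) T :=
        mul_le_mul_of_nonneg_right (le_max_left _ _) hpos.le
    _ ≤ max ρ 0 * totalDist (P t) T₀ :=
        mul_le_mul_of_nonneg_left (hT.2 _ hT₀) (le_max_right _ _)
    _ < _ := ht f _ hnear

theorem mainTheorem2 (d : ℕ) (hd : 1 ≤ d) :
    -- MM is a `(2 - 1/(2d))`-approximation algorithm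
    (∀ (n k : ℕ) (P : Fin n → Fin d → ℝ), 1 ≤ n → k ≤ n →
      (candidateMedians P).card ≤ n ^ d ∧
      (∃ S, IsMMOutput P k S) ∧
      ∀ S T : Finset (Fin n), IsMMOutput P k S → IsOptimal P k T →
        S.card = k ∧ totalDist P S ≤ (2 - 1 / (2 * (d : ℝ))) * totalDist P T) ∧
    -- the factor is tight, even for distinct points and however the ties are broken
    (∀ ρ : ℝ, ρ < 2 - 1 / (2 * (d : ℝ)) →
      ∃ (n k : ℕ) (P : Fin n → Fin d → ℝ), 1 ≤ n ∧ k ≤ n ∧ Function.Injective P ∧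
        ∃ T : Finset (Fin n), IsOptimal P k T ∧ 0 < totalDist P T ∧
          ∀ S : Finset (Fin n), IsMMOutput P k S → ρ * totalDist P T < totalDist P S) := by
  refine ⟨fun n k P hn hk => ⟨card_candidateMedians_le P, exists_isMMOutput hn P hk,
    fun S T hS hT => ⟨hS.card_eq, totalDist_le_of_isMMOutput hd hn P hS hT.1⟩⟩, fun ρ hρ => ?_⟩
  obtain ⟨m, rfl⟩ := Nat.exists_eq_add_of_le' hd
  exact exists_isMMOutput_gt m ρ hρ
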